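/- Let $M$ be a compact metric space with a base point $0\in M$. Let $\mathrm{Lip}_0(M)$ be the real Banach space of all Lipschitz functions $f\colon M\to\mathbb R$ with $f(0)=0$, normed by $\|f\|=\sup\{|f(x)-f(y)|/d(x,y) : x,y\in M,\ x\ne y\}$ (with $\sup\emptyset=0$). Let $\mathcal F(M)$ be the Lipschitz-free space over $M$, that is, the norm-closed linear span in $\mathrm{Lip}_0(M)^*$ of the evaluation functionals $\delta_x\colon f\mapsto f(x)$, $x\in M$, and let $B_{\mathcal F(M)}$ and $S_{\mathcal F(M)}$ be its closed unit ball and unit sphere. For a bounded convex subset $A$ of a real Banach space $X$, a slice of $A$ is a non-empty set of the form $\{x\in A : x^*(x)>\sup_{A}x^*-\alpha\}$ with $x^*\in X^*$ and $\alpha>0$. A point $a\in A$ is an SCD point of $A$ if there is a sequence $(S_n)$ of slices of $A$ such that $a\in\overline{\mathrm{conv}}(B)$ for every $B\subseteq A$ that intersects all the $S_n$; the set of these points is $\mathrm{SCD}(A)$. The set $A$ is an SCD set if there is a sequence $(S_n)$ of slices of $A$ such that $A\subseteq\overline{\mathrm{conv}}(B)$ for every $B\subseteq A$ that intersects all the $S_n$.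 A point $x\in A$ is a strongly exposed point of $A$ if there is $x^*\in X^*$ with $x^*(x)=\sup_A x^*$ such that $x_n\to x$ for every sequence $(x_n)$ in $A$ with $x^*(x_n)\to x^*(x)$; the set of these points is $\mathrm{strexp}(A)$. Theorem. For every $\mu\in S_{\mathcal F(M)}$, the following are equivalent: (i) $\mu\in\mathrm{SCD}(B_{\mathcal F(M)})$; (ii) $\mu\in\overline{\mathrm{conv}}\bigl(\mathrm{strexp}(B_{\mathcal F(M)})\bigr)$. In particular, $B_{\mathcal F(M)}$ is an SCD set if and only if $B_{\mathcal F(M)}=\overline{\mathrm{conv}}\bigl(\mathrm{strexp}(B_{\mathcal F(M)})\bigr)$. -/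

import Mathlib

open Set Metric

noncomputable section

section SCD

variable {X : Type*} [NormedAddCommGroup X] [NormedSpace ℝ X]

/-- The slice `S(A, f, α) = {x ∈ A : f x > sup_A f - α}`, for bounded `A`. -/
def slice (A : Set X) (f : StrongDual ℝ X) (α : ℝ) : Set X :=
  {x | x ∈ A ∧ sSup (f '' A) - α < f x}

/-- `S` is a slice of the bounded set `A`. -/
def IsSlice (A S : Set X) : Prop :=
  S.Nonempty ∧ ∃ (f : StrongDual ℝ X) (α : ℝ), 0 < α ∧ S = slice A f α

/-- The closed convex hull of a set. -/
def closedConv (B : Set X) : Set X := closure (convexHull ℝ B)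

/-- The sequence of sets `V` is determining for the point `a` in `A`: every subset of `A` that
meets all the `V n` contains `a` in its closed convex hull. -/
def IsDeterminingFor (A : Set X) (V : ℕ → Set X) (a : X) : Prop :=
  ∀ B : Set X, B ⊆ A → (∀ n, (B ∩ V n).Nonempty) → a ∈ closedConv B

/-- The set of slicely countably determined points of `A`. -/
def scdPoints (A : Set X) : Set X :=
  {a | a ∈ A ∧ ∃ V : ℕ → Set X, (∀ n, IsSlice A (V n)) ∧ IsDeterminingFor A V a}

/-- `A` is a slicely countably determined set: one sequence of slices of `A` is such that
`A ⊆ closedConv B` for every subset `B` of `A` that meets all of these slices. -/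
def IsSCDSet (A : Set X) : Prop :=
  ∃ V : ℕ → Set X, (∀ n, IsSlice A (V n)) ∧
    ∀ B : Set X, B ⊆ A → (∀ n, (B ∩ V n).Nonempty) → A ⊆ closedConv B

/-- The set of strongly exposed points of `A`: the points `x ∈ A` for which some functional `f`
attains its supremum over `A` at `x`, and `x n → x` for every sequence in `A` with
`f (x n) → f x`. -/
def stronglyExposedPoints (A : Set X) : Set X :=
  {x | x ∈ A ∧ ∃ f : StrongDual ℝ X, (∀ y ∈ A, f y ≤ f x) ∧
    ∀ u : ℕ → X, (∀ n, u n ∈ A) →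
      Filter.Tendsto (fun n => f (u n)) Filter.atTop (nhds (f x)) →
      Filter.Tendsto u Filter.atTop (nhds x)}

end SCD

section LipschitzFree

variable {M : Type*} [MetricSpace M]

/-- The real Lipschitz functions on `M` that vanish at the base point `z`, as a subspace of the
space of all functions. -/
def lip0Submodule (z : M) : Submodule ℝ (M → ℝ) where
  carrier := {f | f z = 0 ∧ ∃ K : NNReal, LipschitzWith K f}
  zero_mem' := ⟨rfl, 0, LipschitzWith.const 0⟩
  add_mem' := by
    rintro f g ⟨hf, K, hK⟩ ⟨hg, L, hL⟩
    exact ⟨by simp [hf, hg], K + L, hK.add hL⟩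
  smul_mem' := by
    rintro c f ⟨hf, K, hK⟩
    refine ⟨by simp [hf], ‖c‖₊ * K, LipschitzWith.of_dist_le_mul fun x y => ?_⟩
    have h := hK.dist_le_mul x y
    simp only [Pi.smul_apply, smul_eq_mul, Real.dist_eq, NNReal.coe_mul, coe_nnnorm,
      Real.norm_eq_abs, ← mul_sub, abs_mul] at h ⊢
    rw [mul_assoc]
    exact mul_le_mul_of_nonneg_left h (abs_nonneg c)

/-- The space `Lip₀(M)` of real Lipschitz functions on `M` vanishing at the base point `z`. -/
def Lip0 (z : M) : Type _ := lip0Submodule z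

namespace Lip0

instance (z : M) : AddCommGroup (Lip0 z) := inferInstanceAs (AddCommGroup (lip0Submodule z))

instance (z : M) : Module ℝ (Lip0 z) := inferInstanceAs (Module ℝ (lip0Submodule z))

instance (z : M) : CoeFun (Lip0 z) (fun _ => M → ℝ) := ⟨fun f => f.1⟩

variable {z : M}

@[ext] theorem ext {f g : Lip0 z} (h : ∀ x, f x = g x) : f = g := Subtype.ext (funext h)

@[simp] theorem zero_apply (x : M) : (0 : Lip0 z) x = 0 := rfl

@[simp] theorem add_apply (f g : Lip0 z) (x : M) : (f + g) x = f x + g x := rfl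

@[simp] theorem smul_apply (c : ℝ) (f : Lip0 z) (x : M) : (c • f) x = c * f x := rfl

@[simp] theorem apply_base (f : Lip0 z) : f z = 0 := f.2.1

/-- The norm is the best Lipschitz constant,
`‖f‖ = sup {|f x - f y| / d(x, y) : x, y ∈ M, x ≠ y}` (it is `0` if `M` is a single point). -/
instance : Norm (Lip0 z) :=
  ⟨fun f => sSup {r : ℝ | ∃ x y : M, x ≠ y ∧ r = |f x - f y| / dist x y}⟩

theorem norm_def (f : Lip0 z) :
    ‖f‖ = sSup {r : ℝ | ∃ x y : M, x ≠ y ∧ r = |f x - f y| / dist x y} := rfl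

theorem norm_nonneg' (f : Lip0 z) : 0 ≤ ‖f‖ := by
  refine Real.sSup_nonneg ?_
  rintro r ⟨x, y, -, rfl⟩
  positivity

theorem bddAbove_slopes (f : Lip0 z) :
    BddAbove {r : ℝ | ∃ x y : M, x ≠ y ∧ r = |f x - f y| / dist x y} := by
  obtain ⟨K, hK⟩ := f.2.2
  refine ⟨K, ?_⟩
  rintro r ⟨x, y, hxy, rfl⟩
  rw [div_le_iff₀ (dist_pos.2 hxy), ← Real.dist_eq]
  exact hK.dist_le_mul x y

theorem abs_sub_le (f : Lip0 z) (x y : M) : |f x - f y| ≤ ‖f‖ * dist x y := by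
  rcases eq_or_ne x y with rfl | hxy
  · simp
  · rw [← div_le_iff₀ (dist_pos.2 hxy)]
    exact le_csSup (bddAbove_slopes f) ⟨x, y, hxy, rfl⟩

theorem norm_le_of {f : Lip0 z} {C : ℝ} (hC : 0 ≤ C)
    (h : ∀ x y, |f x - f y| ≤ C * dist x y) : ‖f‖ ≤ C := by
  refine Real.sSup_le ?_ hC
  rintro r ⟨x, y, hxy, rfl⟩
  rw [div_le_iff₀ (dist_pos.2 hxy)]
  exact h x y

theorem norm_smul_le' (c : ℝ) (f : Lip0 z) : ‖c • f‖ ≤ |c| * ‖f‖ := by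
  refine norm_le_of (mul_nonneg (abs_nonneg c) (norm_nonneg' f)) fun x y => ?_
  rw [smul_apply, smul_apply, ← mul_sub, abs_mul, mul_assoc]
  exact mul_le_mul_of_nonneg_left (abs_sub_le f x y) (abs_nonneg c)

theorem normedSpaceCore (z : M) : NormedSpace.Core ℝ (Lip0 z) where
  norm_nonneg := norm_nonneg'
  norm_smul c f := by
    rw [Real.norm_eq_abs]
    refine le_antisymm (norm_smul_le' c f) ?_
    rcases eq_or_ne c 0 with rfl | hc
    · simpa using norm_nonneg' _
    · have h := norm_smul_le' c⁻¹ (c • f)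
      rw [smul_smul, inv_mul_cancel₀ hc, one_smul, abs_inv] at h
      rwa [← le_inv_mul_iff₀ (abs_pos.2 hc)]
  norm_triangle f g := by
    refine norm_le_of (add_nonneg (norm_nonneg' f) (norm_nonneg' g)) fun x y => ?_
    have hf := abs_sub_le f x y
    have hg := abs_sub_le g x y
    have h := abs_add_le (f x - f y) (g x - g y)
    rw [add_apply, add_apply, add_sub_add_comm, add_mul]
    linarith
  norm_eq_zero_iff f := by
    constructor
    · intro h
      ext x
      have hx := abs_sub_le f x z
      rw [h, zero_mul, apply_base, sub_zero] at hx
      exact abs_nonpos_iff.1 hx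
    · rintro rfl
      exact le_antisymm (norm_le_of le_rfl fun x y => by simp) (norm_nonneg' 0)

instance (z : M) : NormedAddCommGroup (Lip0 z) := NormedAddCommGroup.ofCore (normedSpaceCore z)

instance (z : M) : NormedSpace ℝ (Lip0 z) := NormedSpace.ofCore (normedSpaceCore z)

/-- The evaluation functional `δ_x : f ↦ f x` on `Lip₀(M)`. -/
def delta (z x : M) : StrongDual ℝ (Lip0 z) :=
  LinearMap.mkContinuous
    { toFun := fun f : Lip0 z => f x
      map_add' := fun _ _ => rfl
      map_smul' := fun _ _ => rfl } (dist x z) fun f => by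
    have h := abs_sub_le f x z
    rw [apply_base, sub_zero, mul_comm] at h
    exact h

end Lip0

/-- The Lipschitz-free space `F(M)` over `M` with base point `z`: the norm-closed linear span of
the evaluation functionals in the dual of `Lip₀(M)`, with the norm of that dual. -/
abbrev LipschitzFree (z : M) : Type _ :=
  (Submodule.span ℝ (range (Lip0.delta z))).topologicalClosure

end LipschitzFree

end

section

set_option maxSynthPendingDepth 3

/-! ### Slices and strongly exposed points in a normed space. -/

section Slices

variable {X : Type*} [NormedAddCommGroup X] [NormedSpace ℝ X]

/-! From (ii) to (i): a set meeting slices that shrink to a strongly exposed point has this point in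
its closure. By separability, countably many slices serve a dense set of strongly exposed points
(`exists_slices_closedConv_stronglyExposedPoints_subset`).

From (i) to (ii): the unit ball is the closed convex hull of the molecules, and molecules of pairs
at distance at least `δ` form a compact set. A slice whose molecules all lie in this set contains a
strongly exposed point (`exists_mem_stronglyExposedPoints_slice`), so any other slice contains
molecules of arbitrarily close pairs. Given a determining sequence for `μ`, pick from each slice a
strongly exposed point or, failing that, such a molecule. A tiny uniform change of a 1-Lipschitz
function can make it equal to `-1` on that molecule (`exists_slope_eq_one`), while it stays almost
norming for `μ` and negative on the molecules picked before. A convex combination close to `μ` must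
then give these molecules small weight, so `μ` is close to the convex hull of the strongly exposed
points (`mem_closedConv_of_approx`). -/

theorem closedConv_subset {B C : Set X} (hC : Convex ℝ C) (hC' : IsClosed C) (h : B ⊆ C) :
    closedConv B ⊆ C :=
  closure_minimal (convexHull_min h hC) hC'

theorem subset_closedConv (B : Set X) : B ⊆ closedConv B :=
  (subset_convexHull ℝ B).trans subset_closure

theorem convex_closedConv (B : Set X) : Convex ℝ (closedConv B) :=
  (convex_convexHull ℝ B).closure

theorem isClosed_closedConv (B : Set X) : IsClosed (closedConv B) := isClosed_closure

theorem mem_closure_of_meets_slices {A B : Set X} {x : X} (hx : x ∈ A) {f : StrongDual ℝ X}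
    (hf : ∀ y ∈ A, f y ≤ f x)
    (hu : ∀ u : ℕ → X, (∀ n, u n ∈ A) →
      Filter.Tendsto (fun n => f (u n)) Filter.atTop (nhds (f x)) →
      Filter.Tendsto u Filter.atTop (nhds x))
    (hB : B ⊆ A) (h : ∀ n : ℕ, (B ∩ slice A f (1 / ((n : ℝ) + 1))).Nonempty) :
    x ∈ closure B := by
  have hs : sSup (f '' A) = f x :=
    IsGreatest.csSup_eq ⟨mem_image_of_mem f hx, by rintro _ ⟨y, hy, rfl⟩; exact hf y hy⟩
  choose b hb using h
  refine mem_closure_of_tendsto (hu b (fun n => hB (hb n).1) ?_)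
    (Filter.Eventually.of_forall fun n => (hb n).1)
  refine tendsto_of_tendsto_of_tendsto_of_le_of_le (g := fun n : ℕ => f x - 1 / ((n : ℝ) + 1))
    ?_ tendsto_const_nhds (fun n => ?_) fun n => hf _ (hB (hb n).1)
  · simpa using (tendsto_const_nhds (x := f x)).sub
      (tendsto_one_div_add_atTop_nhds_zero_nat (𝕜 := ℝ))
  · have := (hb n).2.2
    rw [hs] at this
    exact this.le

/-- Separability gives a countable dense set of strongly exposed points; each contributes the slices
of width `1 / (n + 1)` of its exposing functional. -/
theorem exists_slices_closedConv_stronglyExposedPoints_subset [TopologicalSpace.SeparableSpace X]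
    {A : Set X} (hne : (stronglyExposedPoints A).Nonempty) :
    ∃ V : ℕ → Set X, (∀ n, IsSlice A (V n)) ∧ ∀ B : Set X, B ⊆ A → (∀ n, (B ∩ V n).Nonempty) →
      closedConv (stronglyExposedPoints A) ⊆ closedConv B := by
  have := UniformSpace.secondCountable_of_separable X
  obtain ⟨Q, hQ, hQc, hQd⟩ := (TopologicalSpace.IsSeparable.of_separableSpace
    (stronglyExposedPoints A)).exists_countable_dense_subset
  have hQne : Q.Nonempty := by
    rw [← closure_nonempty_iff]
    exact hne.mono hQd
  obtain ⟨q, rfl⟩ := hQc.exists_eq_range hQne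
  have hq : ∀ n, q n ∈ stronglyExposedPoints A := fun n => hQ (mem_range_self n)
  choose hqA f hf hu using hq
  refine ⟨fun n => slice A (f n.unpair.1) (1 / ((n.unpair.2 : ℝ) + 1)), fun n => ?_,
    fun B hB hV => ?_⟩
  · have hs : sSup (f n.unpair.1 '' A) = f n.unpair.1 (q n.unpair.1) :=
      IsGreatest.csSup_eq ⟨mem_image_of_mem _ (hqA _), by rintro _ ⟨y, hy, rfl⟩; exact hf _ y hy⟩
    have hp : (0 : ℝ) < 1 / ((n.unpair.2 : ℝ) + 1) := by positivity
    refine ⟨⟨q n.unpair.1, hqA _, ?_⟩, f n.unpair.1, _, hp, rfl⟩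
    rw [hs]
    linarith
  · refine closedConv_subset (convex_closedConv B) (isClosed_closedConv B) (hQd.trans ?_)
    refine closure_minimal ?_ (isClosed_closedConv B)
    rintro _ ⟨k, rfl⟩
    refine closure_mono (subset_convexHull ℝ B)
      (mem_closure_of_meets_slices (hqA k) (hf k) (hu k) hB fun n => ?_)
    simpa using hV (Nat.pair k n)

variable (X) in
-- The form is `∑ 2⁻ⁿ gₙ ⊗ gₙ`, where `gₙ` norms the `n`-th term of a dense sequence; it is definite
-- because the `gₙ` separate points. It serves as the square of a Hilbert norm in a quadratic
-- perturbation.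
theorem exists_posDef_bilinear [TopologicalSpace.SeparableSpace X] :
    ∃ b : X →L[ℝ] X →L[ℝ] ℝ, (∀ x y, b x y = b y x) ∧ ∀ x, x ≠ 0 → 0 < b x x := by
  have hg : ∀ n, ∃ g : StrongDual ℝ X, ‖g‖ ≤ 1 ∧
      g (TopologicalSpace.denseSeq X n) = ‖TopologicalSpace.denseSeq X n‖ := fun n => by
    simpa using exists_dual_vector'' ℝ (TopologicalSpace.denseSeq X n)
  choose g hg hgx using hg
  let T : ℕ → X →L[ℝ] X →L[ℝ] ℝ := fun n => ((1 / 2 : ℝ) ^ n) • (g n).smulRight (g n)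
  have hTn : ∀ n, ‖T n‖ ≤ (1 / 2 : ℝ) ^ n := by
    intro n
    have h1 : ‖(g n).smulRight (g n)‖ ≤ 1 := by
      rw [ContinuousLinearMap.norm_smulRight_apply]
      exact mul_le_one₀ (hg n) (norm_nonneg _) (hg n)
    simp only [T]
    rw [norm_smul, Real.norm_of_nonneg (by positivity)]
    exact mul_le_of_le_one_right (by positivity) h1
  have hT : Summable T := summable_geometric_two.of_norm_bounded hTn
  have hb : ∀ x y, HasSum (fun n => (1 / 2 : ℝ) ^ n * (g n x * g n y)) ((∑' n, T n) x y) := by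
    intro x y
    let φ : (X →L[ℝ] X →L[ℝ] ℝ) →L[ℝ] ℝ :=
      (ContinuousLinearMap.apply ℝ ℝ y).comp (ContinuousLinearMap.apply ℝ (X →L[ℝ] ℝ) x)
    have h : HasSum (fun n => φ (T n)) (φ (∑' n, T n)) := hT.hasSum.mapL φ
    have e : (fun n => φ (T n)) = fun n => (1 / 2 : ℝ) ^ n * (g n x * g n y) := by
      funext n
      simp [φ, T]
    rw [e] at h
    exact h
  refine ⟨∑' n, T n, fun x y => ?_, fun x hx => ?_⟩
  · refine (hb x y).unique ?_
    simpa [mul_comm] using hb y x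
  · obtain ⟨n, hn⟩ : ∃ n, g n x ≠ 0 := by
      by_contra! h
      obtain ⟨n, hn⟩ := (TopologicalSpace.denseRange_denseSeq X).exists_dist_lt x
        (ε := ‖x‖ / 2) (by positivity)
      rw [dist_eq_norm] at hn
      have h1 : ‖TopologicalSpace.denseSeq X n‖ ≤ ‖x - TopologicalSpace.denseSeq X n‖ := by
        have h2 : g n (TopologicalSpace.denseSeq X n - x) = ‖TopologicalSpace.denseSeq X n‖ := by
          rw [map_sub, h, hgx, sub_zero]
        rw [← h2, norm_sub_rev]
        exact (le_abs_self _).trans ((g n).le_of_opNorm_le (hg n) _ |>.trans (by simp))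
      have h3 := norm_le_norm_add_norm_sub' x (TopologicalSpace.denseSeq X n)
      linarith
    rw [← (hb x x).tsum_eq]
    exact (hb x x).summable.tsum_pos (fun k => mul_nonneg (by positivity) (mul_self_nonneg _)) n
      (mul_pos (by positivity) (mul_self_pos.2 hn))

/-- A functional strongly exposes the closed convex hull of `D` at `x` as soon as it strongly
exposes `D` at `x`. -/
theorem mem_stronglyExposedPoints_of_generating {A D : Set X} (hA : A = closedConv D)
    {R : ℝ} {x : X} (hx : x ∈ A) (hD : ∀ d ∈ D, ‖d - x‖ ≤ R) (f : StrongDual ℝ X)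
    (hf : ∀ d ∈ D, f d ≤ f x)
    (h : ∀ ε > 0, ∃ η > 0, ∀ d ∈ D, f x - η < f d → ‖d - x‖ ≤ ε) :
    x ∈ stronglyExposedPoints A := by
  refine ⟨hx, f, ?_, fun u hu hfu => ?_⟩
  · rw [hA]
    exact closedConv_subset (convex_halfSpace_le f.isLinear (f x))
      (isClosed_le f.continuous continuous_const) hf
  · have hbound : ∀ ε > 0, ∃ c, ∀ y ∈ A, ‖y - x‖ ≤ ε + c * (f x - f y) := by
      intro ε hε
      obtain ⟨η, hη, hd⟩ := h ε hε
      refine ⟨|R| / η, ?_⟩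
      rw [hA]
      refine closedConv_subset (C := {y | ‖y - x‖ ≤ ε + |R| / η * (f x - f y)}) ?_ ?_ ?_
      · intro y hy w hw a b ha hb hab
        simp only [mem_ofPred_eq] at hy hw ⊢
        have e1 : a • y + b • w - x = a • (y - x) + b • (w - x) := by
          rw [smul_sub, smul_sub, sub_add_sub_comm, ← add_smul, hab, one_smul]
        have e2 : ‖a • y + b • w - x‖ ≤ a * ‖y - x‖ + b * ‖w - x‖ := by
          rw [e1]
          refine (norm_add_le _ _).trans_eq ?_
          rw [norm_smul, norm_smul, Real.norm_of_nonneg ha, Real.norm_of_nonneg hb]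
        have e3 := mul_le_mul_of_nonneg_left hy ha
        have e4 := mul_le_mul_of_nonneg_left hw hb
        rw [map_add, map_smul, map_smul, smul_eq_mul, smul_eq_mul]
        obtain rfl : b = 1 - a := by linarith
        linarith
      · exact isClosed_le (by fun_prop) (by fun_prop)
      · intro d hdD
        have h0 := sub_nonneg.2 (hf d hdD)
        by_cases hlt : f x - η < f d
        · exact (hd d hdD hlt).trans (le_add_of_nonneg_right (by positivity))
        · have h1 : |R| ≤ |R| / η * (f x - f d) := by
            rw [div_mul_eq_mul_div, le_div_iff₀ hη]
            exact mul_le_mul_of_nonneg_left (by linarith) (abs_nonneg R)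
          exact (hD d hdD).trans ((le_abs_self R).trans (by linarith))
    rw [Metric.tendsto_atTop]
    intro ε hε
    obtain ⟨c, hc⟩ := hbound (ε / 2) (by positivity)
    have ht : Filter.Tendsto (fun n => ε / 2 + c * (f x - f (u n))) Filter.atTop
        (nhds (ε / 2)) := by
      simpa using ((hfu.const_sub (f x)).const_mul c).const_add (ε / 2)
    obtain ⟨N, hN⟩ := Filter.eventually_atTop.1 (ht.eventually_lt_const (half_lt_self hε))
    exact ⟨N, fun n hn => by
      rw [dist_eq_norm]
      exact (hc _ (hu n)).trans_lt (hN n hn)⟩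

/-- If the part of the generating set `D` that lies in a slice is contained in a compact set, then
the slice contains a strongly exposed point. -/
theorem exists_mem_stronglyExposedPoints_slice [TopologicalSpace.SeparableSpace X]
    {D K : Set X} (hD : closedBall (0 : X) 1 = closedConv D) (hK : IsCompact K)
    (hKA : K ⊆ closedBall 0 1) {f : StrongDual ℝ X} {α : ℝ} (hα : 0 < α)
    (hDK : ∀ d ∈ D, sSup (f '' closedBall 0 1) - α < f d → d ∈ K) :
    ∃ x ∈ slice (closedBall 0 1) f α, x ∈ stronglyExposedPoints (closedBall (0 : X) 1) := by
  set s := sSup (f '' closedBall 0 1) with hs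
  obtain ⟨b, hsymm, hpos⟩ := exists_posDef_bilinear X
  have hDA : D ⊆ closedBall 0 1 := hD ▸ subset_closedConv D
  obtain ⟨d₁, hd₁, hfd₁⟩ : ∃ d ∈ D, s - α / 4 < f d := by
    by_contra! h
    have h1 : closedBall (0 : X) 1 ⊆ {y | f y ≤ s - α / 4} := by
      rw [hD]
      exact closedConv_subset (convex_halfSpace_le f.isLinear _)
        (isClosed_le f.continuous continuous_const) h
    have h2 : s ≤ s - α / 4 := by
      refine csSup_le ⟨f 0, mem_image_of_mem f (by simp)⟩ ?_
      rintro _ ⟨y, hy, rfl⟩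
      exact h1 hy
    linarith
  have hd₁K : d₁ ∈ K := hDK d₁ hd₁ (by linarith)
  -- With this `τ`, the functional `F` below differs from `f` by at most `α / 4` on the ball.
  obtain ⟨τ, hτ, hτb⟩ : ∃ τ > 0, 2 * τ * ‖b‖ ≤ α / 4 := by
    refine ⟨α / (8 * (‖b‖ + 1)), by positivity, ?_⟩
    rw [mul_div_assoc', div_mul_eq_mul_div, div_le_iff₀ (by positivity)]
    nlinarith [norm_nonneg b]
  -- At a maximum `k` of `f + τ b(x, x)` on `K`, expanding `b(x - k, x - k)` shows that the
  -- linearisation `F` peaks at `k` with quadratic gap `τ b(x - k, x - k)`.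
  obtain ⟨k, hkK, hk⟩ := hK.exists_isMaxOn ⟨d₁, hd₁K⟩
    (f := fun x => f x + τ * b x x) (by fun_prop)
  have hk1 : ‖k‖ ≤ 1 := by simpa using hKA hkK
  let F : StrongDual ℝ X := f + (2 * τ) • b k
  have hF : ∀ x, F x = f x + 2 * τ * b k x := fun x => by simp [F]
  have hFf : ∀ x ∈ closedBall (0 : X) 1, |F x - f x| ≤ α / 4 := by
    intro x hx
    have hx1 : ‖x‖ ≤ 1 := by simpa using hx
    have h1 : |b k x| ≤ ‖b‖ := by
      refine (b.le_opNorm₂ k x).trans ?_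
      calc ‖b‖ * ‖k‖ * ‖x‖ ≤ ‖b‖ * 1 * 1 := by gcongr
        _ = ‖b‖ := by ring
    rw [hF, add_sub_cancel_left, abs_mul, abs_of_pos (by positivity)]
    exact (mul_le_mul_of_nonneg_left h1 (by positivity)).trans hτb
  have hquad : ∀ x ∈ K, F x + τ * b (x - k) (x - k) ≤ F k := by
    intro x hx
    have h1 := hk hx
    simp only [mem_ofPred_eq] at h1
    rw [hF, hF]
    simp only [map_sub, sub_apply]
    rw [hsymm x k]
    nlinarith
  have hFk : s - α / 2 < F k := by
    have h1 := hquad d₁ hd₁K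
    have h2 : 0 ≤ b (d₁ - k) (d₁ - k) := by
      rcases eq_or_ne (d₁ - k) 0 with h | h
      · simp [h]
      · exact (hpos _ h).le
    have h3 := abs_le.1 (hFf d₁ (hDA hd₁))
    have h4 := mul_nonneg hτ.le h2
    linarith [h3.1]
  have hfar : ∀ d ∈ D, F k - α / 4 < F d → d ∈ K := fun d hd h => hDK d hd (by
    have h1 := abs_le.1 (hFf d (hDA hd))
    linarith [h1.2])
  refine ⟨k, ⟨hKA hkK, ?_⟩, mem_stronglyExposedPoints_of_generating hD (R := 2) (hKA hkK) ?_ F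
    ?_ ?_⟩
  · have h1 := abs_le.1 (hFf k (hKA hkK))
    linarith [h1.2]
  · intro d hd
    have : ‖d‖ ≤ 1 := by simpa using hDA hd
    linarith [norm_sub_le d k]
  · intro d hd
    by_contra! h
    have h1 := hquad d (hfar d hd (by linarith))
    have h2 : d - k ≠ 0 := by
      intro h0
      rw [sub_eq_zero.1 h0] at h
      exact lt_irrefl _ h
    have h3 := mul_pos hτ (hpos _ h2)
    linarith
  · intro ε hε
    -- By compactness, the gap is bounded below on the points of `K` at distance at least `ε` from
    -- `k`.
    have hc : IsCompact (K ∩ {x | ε ≤ ‖x - k‖}) :=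
      hK.inter_right (isClosed_le (by fun_prop) (by fun_prop))
    rcases (K ∩ {x | ε ≤ ‖x - k‖}).eq_empty_or_nonempty with he | hne
    · refine ⟨α / 4, by positivity, fun d hd h => ?_⟩
      by_contra! h1
      have : d ∈ K ∩ {x | ε ≤ ‖x - k‖} := ⟨hfar d hd h, h1.le⟩
      rw [he] at this
      exact this
    · obtain ⟨w, ⟨-, hw⟩, hmin⟩ := hc.exists_isMinOn hne
        (f := fun x => b (x - k) (x - k)) (by fun_prop)
      have hw0 : w - k ≠ 0 := norm_pos_iff.1 (hε.trans_le hw)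
      refine ⟨min (α / 4) (τ * b (w - k) (w - k)),
        lt_min (by positivity) (mul_pos hτ (hpos _ hw0)), fun d hd h => ?_⟩
      by_contra! h1
      have hdK := hfar d hd (by linarith [min_le_left (α / 4) (τ * b (w - k) (w - k))])
      have h2 : b (w - k) (w - k) ≤ b (d - k) (d - k) := hmin ⟨hdK, h1.le⟩
      have h3 := hquad d hdK
      have h4 := mul_le_mul_of_nonneg_left h2 hτ.le
      linarith [min_le_right (α / 4) (τ * b (w - k) (w - k))]

end Slices

noncomputable section

/-! ### The Lipschitz-free space and its molecules. -/

section Molecules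

variable {M : Type*} [MetricSpace M] {z : M}

namespace LipschitzFree

variable (z) in
/-- The canonical embedding of `M` into its Lipschitz-free space. -/
def embed (x : M) : LipschitzFree z :=
  ⟨Lip0.delta z x, Submodule.le_topologicalClosure _ (Submodule.subset_span (mem_range_self x))⟩

theorem embed_base : embed z z = 0 :=
  Subtype.ext (ContinuousLinearMap.ext fun f => f.apply_base)

theorem norm_embed_sub_le (x y : M) : ‖embed z x - embed z y‖ ≤ dist x y := by
  refine ContinuousLinearMap.opNorm_le_bound _ dist_nonneg fun f => ?_
  rw [mul_comm]
  exact Lip0.abs_sub_le f x y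

theorem continuous_embed : Continuous (embed z : M → LipschitzFree z) :=
  (LipschitzWith.of_dist_le_mul (K := 1) fun x y => by
    rw [dist_eq_norm, NNReal.coe_one, one_mul]
    exact norm_embed_sub_le x y).continuous

/-- A property of elements of the Lipschitz-free space holds everywhere if it holds on the image
of `M` and is inherited by sums, multiples and limits. -/
theorem induction_on {p : LipschitzFree z → Prop} (hembed : ∀ x, p (embed z x)) (h0 : p 0)
    (hadd : ∀ μ ν, p μ → p ν → p (μ + ν)) (hsmul : ∀ (c : ℝ) μ, p μ → p (c • μ))
    (hclosed : IsClosed {μ | p μ}) (μ : LipschitzFree z) : p μ := by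
  have hspan : ∀ (ν : StrongDual ℝ (Lip0 z)) (hν : ν ∈ Submodule.span ℝ (range (Lip0.delta z))),
      p ⟨ν, Submodule.le_topologicalClosure _ hν⟩ := by
    intro ν hν
    induction hν using Submodule.span_induction with
    | mem ν h =>
      obtain ⟨x, rfl⟩ := h
      exact hembed x
    | zero => exact h0
    | add ν ρ _ _ hν hρ => exact hadd _ _ hν hρ
    | smul c ν _ hν => exact hsmul c _ hν
  have hμ : μ ∈ closure {ν : LipschitzFree z |
      ν.1 ∈ Submodule.span ℝ (range (Lip0.delta z))} := by
    rw [Metric.mem_closure_iff]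
    intro ε hε
    obtain ⟨ν, hν, hd⟩ := Metric.mem_closure_iff.1 μ.2 ε hε
    exact ⟨⟨ν, Submodule.le_topologicalClosure _ hν⟩, hν, hd⟩
  exact closure_minimal (fun ν hν => hspan ν.1 hν) hclosed hμ

instance separableSpace [TopologicalSpace.SeparableSpace M] :
    TopologicalSpace.SeparableSpace (LipschitzFree z) := by
  have h : TopologicalSpace.IsSeparable (range (Lip0.delta z)) :=
    TopologicalSpace.isSeparable_range (continuous_subtype_val.comp continuous_embed)
  exact (h.span (R := ℝ)).closure.separableSpace

/-- The elementary molecule `(δ_x - δ_y) / d(x, y)`. -/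
def molecule (z x y : M) : LipschitzFree z := (dist x y)⁻¹ • (embed z x - embed z y)

@[simp] theorem molecule_apply (x y : M) (f : Lip0 z) :
    (molecule z x y).1 f = (dist x y)⁻¹ * (f x - f y) := rfl

theorem norm_molecule_le (x y : M) : ‖molecule z x y‖ ≤ 1 := by
  rw [molecule, norm_smul, Real.norm_of_nonneg (by positivity)]
  exact (mul_le_mul_of_nonneg_left (norm_embed_sub_le x y) (by positivity)).trans
    inv_mul_le_one

variable (z) in
/-- The set of all elementary molecules. -/
def molecules : Set (LipschitzFree z) := {m | ∃ x y : M, x ≠ y ∧ m = molecule z x y}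

/-- The Lipschitz function that represents a functional on the Lipschitz-free space. -/
def toLip0 (φ : StrongDual ℝ (LipschitzFree z)) : Lip0 z :=
  ⟨fun x => φ (embed z x), (congrArg φ embed_base).trans (map_zero φ), ‖φ‖₊, LipschitzWith.of_dist_le_mul
    fun x y => by
      rw [Real.dist_eq, ← map_sub]
      exact (φ.le_opNorm _).trans
        (mul_le_mul_of_nonneg_left (norm_embed_sub_le x y) (norm_nonneg φ))⟩

theorem apply_toLip0 (φ : StrongDual ℝ (LipschitzFree z)) (μ : LipschitzFree z) :
    μ.1 (toLip0 φ) = φ μ := by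
  induction μ using induction_on with
  | hembed x => rfl
  | h0 => simp
  | hadd μ ν hμ hν => rw [map_add, ← hμ, ← hν]; rfl
  | hsmul c μ hμ => rw [map_smul, ← hμ]; rfl
  | hclosed =>
    refine isClosed_eq ?_ φ.continuous
    exact ((ContinuousLinearMap.apply ℝ ℝ (toLip0 φ)).continuous).comp continuous_subtype_val

/-- By Hahn–Banach: a functional is a Lipschitz function, and its supremum over the molecules is its
Lipschitz constant, since exchanging `x` and `y` changes the sign. -/
theorem closedBall_eq_closedConv_molecules [Nontrivial M] :
    closedBall (0 : LipschitzFree z) 1 = closedConv (molecules z) := by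
  refine Subset.antisymm (fun μ hμ => ?_)
    (closedConv_subset (convex_closedBall _ _) isClosed_closedBall ?_)
  · by_contra hμc
    obtain ⟨φ, c, hφ, hc⟩ := geometric_hahn_banach_closed_point
      (convex_closedConv (molecules z)) (isClosed_closedConv _) hμc
    have hm : ∀ x y, x ≠ y → (dist x y)⁻¹ * (toLip0 φ x - toLip0 φ y) ≤ c := by
      intro x y hxy
      rw [← molecule_apply, apply_toLip0]
      exact (hφ _ (subset_closedConv _ ⟨x, y, hxy, rfl⟩)).le
    have hm' : ∀ x y, x ≠ y → |toLip0 φ x - toLip0 φ y| ≤ c * dist x y := by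
      intro x y hxy
      have h1 := hm x y hxy
      have h2 := hm y x hxy.symm
      rw [dist_comm y x] at h2
      rw [inv_mul_le_iff₀ (dist_pos.2 hxy)] at h1 h2
      rw [abs_le]
      constructor <;> linarith
    have hc0 : 0 ≤ c := by
      obtain ⟨x, y, hxy⟩ := exists_pair_ne M
      have := (abs_nonneg _).trans (hm' x y hxy)
      exact nonneg_of_mul_nonneg_left this (dist_pos.2 hxy)
    have hn : ‖toLip0 φ‖ ≤ c := Lip0.norm_le_of hc0 fun x y => by
      rcases eq_or_ne x y with rfl | hxy
      · simp
      · exact hm' x y hxy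
    have h1 : φ μ ≤ c := by
      rw [← apply_toLip0]
      have hμ1 : ‖μ.1‖ ≤ 1 := by simpa using hμ
      calc μ.1 (toLip0 φ) ≤ ‖μ.1 (toLip0 φ)‖ := le_abs_self _
        _ ≤ ‖μ.1‖ * ‖toLip0 φ‖ := μ.1.le_opNorm _
        _ ≤ 1 * c := by gcongr
        _ = c := one_mul c
    linarith
  · rintro _ ⟨x, y, -, rfl⟩
    simpa using norm_molecule_le x y

theorem isCompact_molecules_of_le_dist [CompactSpace M] {δ : ℝ} (hδ : 0 < δ) :
    IsCompact ((fun p : M × M => molecule z p.1 p.2) '' {p | δ ≤ dist p.1 p.2}) := by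
  refine IsCompact.image_of_continuousOn
    (isClosed_le continuous_const (by fun_prop)).isCompact ?_
  refine ContinuousOn.smul (f := fun p : M × M => (dist p.1 p.2)⁻¹)
    (ContinuousOn.inv₀ continuous_dist.continuousOn fun p hp => ?_) ?_
  · exact (hδ.trans_le hp).ne'
  · exact ((continuous_embed.comp continuous_fst).sub
      (continuous_embed.comp continuous_snd)).continuousOn

/-- A slice of the unit ball without strongly exposed points contains molecules of arbitrarily
close points. -/
theorem exists_molecule_mem_slice [CompactSpace M] [Nontrivial M]
    {f : StrongDual ℝ (LipschitzFree z)} {α : ℝ} (hα : 0 < α)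
    (h : ∀ μ ∈ slice (closedBall (0 : LipschitzFree z) 1) f α,
      μ ∉ stronglyExposedPoints (closedBall (0 : LipschitzFree z) 1)) {δ : ℝ} (hδ : 0 < δ) :
    ∃ x y : M, x ≠ y ∧ dist x y < δ ∧
      molecule z x y ∈ slice (closedBall (0 : LipschitzFree z) 1) f α := by
  -- Otherwise all molecules in the slice come from pairs at distance at least `δ`, a compact
  -- family.
  by_contra! hloc
  obtain ⟨μ, hμ, hμs⟩ := exists_mem_stronglyExposedPoints_slice
    (closedBall_eq_closedConv_molecules (z := z)) (isCompact_molecules_of_le_dist (z := z) hδ)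
    (by rintro _ ⟨p, -, rfl⟩; simpa using norm_molecule_le p.1 p.2) (f := f) hα
    (by
      rintro _ ⟨x, y, hxy, rfl⟩ hs
      refine ⟨(x, y), ?_, rfl⟩
      by_contra hlt
      exact hloc x y hxy (not_le.1 hlt) ⟨by simpa using norm_molecule_le x y, hs⟩)
  exact h μ hμ hμs

/-! ### Uniformly small perturbations of Lipschitz functions. -/

/-- On bounded sets of Lipschitz functions, the elements of the Lipschitz-free space are continuous
with respect to uniform convergence. -/
theorem exists_forall_abs_apply_le (μ : LipschitzFree z) {η : ℝ} (hη : 0 < η) :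
    ∃ r > 0, ∀ g : Lip0 z, ‖g‖ ≤ 2 → (∀ x, |g x| ≤ r) → |μ.1 g| ≤ η := by
  induction μ using induction_on generalizing η with
  | hembed x => exact ⟨η, hη, fun g _ hg => hg x⟩
  | h0 => exact ⟨1, one_pos, fun g _ _ => by simpa using hη.le⟩
  | hadd μ ν hμ hν =>
    obtain ⟨r, hr, h⟩ := hμ (half_pos hη)
    obtain ⟨s, hs, h'⟩ := hν (half_pos hη)
    refine ⟨min r s, lt_min hr hs, fun g hg hgr => ?_⟩
    have h1 := h g hg fun x => (hgr x).trans (min_le_left _ _)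
    have h2 := h' g hg fun x => (hgr x).trans (min_le_right _ _)
    calc |μ.1 g + ν.1 g| ≤ |μ.1 g| + |ν.1 g| := abs_add_le _ _
      _ ≤ η := by linarith
  | hsmul c μ hμ =>
    obtain ⟨r, hr, h⟩ := hμ (η := η / (|c| + 1)) (by positivity)
    refine ⟨r, hr, fun g hg hgr => ?_⟩
    have h1 := h g hg hgr
    rw [le_div_iff₀ (by positivity)] at h1
    calc |c * μ.1 g| = |c| * |μ.1 g| := abs_mul _ _
      _ ≤ η := by nlinarith [abs_nonneg (μ.1 g)]
  | hclosed =>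
    refine isClosed_of_closure_subset fun μ hμ => ?_
    intro η hη
    obtain ⟨ν, hν, hd⟩ := Metric.mem_closure_iff.1 hμ (η / 4) (by positivity)
    obtain ⟨r, hr, h⟩ := hν (half_pos hη)
    refine ⟨r, hr, fun g hg hgr => ?_⟩
    have h1 := h g hg hgr
    have h2 : |(μ - ν).1 g| ≤ η / 4 * 2 := by
      rw [dist_eq_norm] at hd
      exact ((μ - ν).1.le_opNorm g).trans (mul_le_mul hd.le hg (norm_nonneg _) (by positivity))
    calc |μ.1 g| = |(μ - ν).1 g + ν.1 g| := by congr 1; exact (sub_add_cancel _ _).symm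
      _ ≤ |(μ - ν).1 g| + |ν.1 g| := abs_add_le _ _
      _ ≤ η := by linarith

theorem exists_forall_lt_apply (μ : LipschitzFree z) {h : Lip0 z} (hh : ‖h‖ ≤ 1) {c : ℝ}
    (hc : c < μ.1 h) :
    ∃ r > 0, ∀ g : Lip0 z, ‖g‖ ≤ 1 → (∀ x, |g x - h x| ≤ r) → c < μ.1 g := by
  obtain ⟨r, hr, H⟩ := exists_forall_abs_apply_le μ (half_pos (sub_pos.2 hc))
  refine ⟨r, hr, fun g hg hgr => ?_⟩
  -- The difference of two functions of norm at most `1` has norm at most `2`, the bound allowed in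
  -- `exists_forall_abs_apply_le`.
  have h1 := H (g + (-1 : ℝ) • h)
    ((norm_add_le _ _).trans (by rw [norm_smul]; norm_num; linarith))
    (fun x => by
      have := hgr x
      rwa [Lip0.add_apply, Lip0.smul_apply, neg_one_mul, ← sub_eq_add_neg])
  rw [map_add, map_smul, neg_one_smul, ← sub_eq_add_neg] at h1
  linarith [(abs_le.1 h1).1]

/-- A uniformly small perturbation of a `1`-Lipschitz function has slope one between two given
close points. -/
theorem exists_slope_eq_one {h : Lip0 z} (hh : ‖h‖ ≤ 1) {r : ℝ} {u v : M}
    (huv : 2 * dist u v ≤ r) :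
    ∃ g : Lip0 z, ‖g‖ ≤ 1 ∧ (∀ x, |g x - h x| ≤ r) ∧ g u - g v = dist u v := by
  have hlip : ∀ x y, h x - h y ≤ dist x y := fun x y =>
    (le_abs_self _).trans ((Lip0.abs_sub_le h x y).trans
      (mul_le_of_le_one_left dist_nonneg hh))
  have hr : 0 ≤ r := le_trans (by positivity) huv
  -- A cone of slope one with apex at `u`, cut off below by `h - r`. It lies below `h`, and `2 *
  -- dist u v ≤ r` makes the cone the larger term at `v` too.
  set φ : M → ℝ := fun x => max (h x - r) (h u - dist x u) with hφ
  have hφlip : ∀ x y, φ x - φ y ≤ dist x y := by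
    intro x y
    rw [sub_le_iff_le_add]
    refine max_le ?_ ?_
    · have := le_max_left (h y - r) (h u - dist y u)
      linarith [hlip x y]
    · have := le_max_right (h y - r) (h u - dist y u)
      linarith [dist_triangle y x u, dist_comm x y]
  have hφ1 : ∀ x, φ x ≤ h x := fun x => max_le (by linarith) (by
    linarith [hlip u x, dist_comm u x])
  have hφ2 : ∀ x, h x - r ≤ φ x := fun x => le_max_left _ _
  have hφabs : ∀ x y, |φ x - φ y| ≤ dist x y := fun x y => by
    rw [abs_le]
    constructor <;> linarith [hφlip x y, hφlip y x, dist_comm x y]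
  -- Restoring the value `0` at the base point costs nothing: `φ - h` and `φ z` both lie in `[-r,
  -- 0]`.
  refine ⟨⟨fun x => φ x - φ z, sub_self _, 1, LipschitzWith.of_dist_le_mul fun x y => ?_⟩,
    Lip0.norm_le_of zero_le_one fun x y => ?_, fun x => ?_, ?_⟩
  · rw [Real.dist_eq, sub_sub_sub_cancel_right, NNReal.coe_one, one_mul]
    exact hφabs x y
  · change |φ x - φ z - (φ y - φ z)| ≤ 1 * dist x y
    rw [sub_sub_sub_cancel_right, one_mul]
    exact hφabs x y
  · change |φ x - φ z - h x| ≤ r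
    have h1 := hφ1 z
    have h2 := hφ2 z
    rw [Lip0.apply_base] at h1 h2
    rw [abs_le]
    constructor <;> linarith [hφ1 x, hφ2 x]
  · change φ u - φ z - (φ v - φ z) = dist u v
    have h1 : φ u = h u := by
      simp only [hφ, dist_self, sub_zero]
      exact max_eq_right (by linarith)
    have h2 : φ v = h u - dist u v := by
      simp only [hφ]
      rw [dist_comm v u]
      exact max_eq_right (by linarith [hlip v u, dist_comm u v])
    rw [h1, h2]
    ring

end LipschitzFree

end Molecules

end

/-! ### Approximating an SCD point by convex combinations. -/

theorem mem_closedConv_of_approx {X : Type*} [NormedAddCommGroup X] [NormedSpace ℝ X]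
    {A : Set X} (hA : A ⊆ closedBall 0 1) (hAne : A.Nonempty) {e : ℕ → X}
    (he : ∀ n, e n ∈ closedBall (0 : X) 1) {h : ℕ → StrongDual ℝ X} (hn : ∀ n, ‖h n‖ ≤ 1)
    (hneg : ∀ n k, k ≤ n → e k ∈ A ∨ h n (e k) < 0) {μ : X} {η : ℝ} (hη : 0 < η)
    (hμ : ∀ n, 1 - η < h n μ) (hμe : μ ∈ closedConv (range e)) :
    ∃ c ∈ convexHull ℝ A, ‖μ - c‖ < 5 * η := by
  have hball : ∀ n, ∀ x ∈ closedBall (0 : X) 1, h n x ≤ 1 := fun n x hx => by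
    have hx1 : ‖x‖ ≤ 1 := by simpa using hx
    calc h n x ≤ ‖h n x‖ := le_abs_self _
      _ ≤ 1 * ‖x‖ := (h n).le_of_opNorm_le (hn n) x
      _ ≤ 1 := by linarith
  -- For `e k` outside `A`, `h n (e k) < 0` makes the bound at least `2`, so any point of `A` serves
  -- as `c`. Since `1 - h n ν` is affine in `ν`, the estimate survives convex combinations; `N`
  -- absorbs their finitely many indices.
  let P : Set X := {ν | ∃ N, ∀ n ≥ N, ∃ c ∈ convexHull ℝ A, ‖ν - c‖ ≤ 2 * (1 - h n ν)}
  have hP : convexHull ℝ (range e) ⊆ P := by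
    refine convexHull_min ?_ ?_
    · rintro _ ⟨k, rfl⟩
      refine ⟨k, fun n hnk => ?_⟩
      rcases hneg n k hnk with hk | hk
      · refine ⟨e k, subset_convexHull ℝ A hk, ?_⟩
        rw [sub_self, norm_zero]
        linarith [hball n _ (he k)]
      · obtain ⟨a, ha⟩ := hAne
        refine ⟨a, subset_convexHull ℝ A ha, ?_⟩
        have h1 : ‖e k‖ ≤ 1 := by simpa using he k
        have h2 : ‖a‖ ≤ 1 := by simpa using hA ha
        linarith [norm_sub_le (e k) a]
    · rintro x ⟨N, hx⟩ y ⟨N', hy⟩ a b ha hb hab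
      refine ⟨max N N', fun n hn' => ?_⟩
      obtain ⟨c, hc, hxc⟩ := hx n ((le_max_left _ _).trans hn')
      obtain ⟨d, hd, hyd⟩ := hy n ((le_max_right _ _).trans hn')
      refine ⟨a • c + b • d, convex_convexHull ℝ A hc hd ha hb hab, ?_⟩
      have e1 : a • x + b • y - (a • c + b • d) = a • (x - c) + b • (y - d) := by
        rw [smul_sub, smul_sub, add_sub_add_comm]
      have e2 : ‖a • (x - c) + b • (y - d)‖ ≤ a * ‖x - c‖ + b * ‖y - d‖ := by
        refine (norm_add_le _ _).trans_eq ?_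
        rw [norm_smul, norm_smul, Real.norm_of_nonneg ha, Real.norm_of_nonneg hb]
      have e3 := mul_le_mul_of_nonneg_left hxc ha
      have e4 := mul_le_mul_of_nonneg_left hyd hb
      rw [e1, map_add, map_smul, map_smul, smul_eq_mul, smul_eq_mul]
      obtain rfl : b = 1 - a := by linarith
      linarith
  -- Here `h N ν > 1 - 2η`, so `ν` is within `4η` of `c`, and `μ` within `5η`.
  obtain ⟨ν, hν, hd⟩ := Metric.mem_closure_iff.1 hμe η hη
  obtain ⟨N, hN⟩ := hP hν
  obtain ⟨c, hc, hνc⟩ := hN N le_rfl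
  rw [dist_eq_norm] at hd
  have h1 : h N (μ - ν) ≤ ‖μ - ν‖ := by
    simpa using (le_abs_self _).trans ((h N).le_of_opNorm_le (hn N) (μ - ν))
  rw [map_sub] at h1
  refine ⟨c, hc, ?_⟩
  have h2 := norm_sub_le_norm_sub_add_norm_sub μ ν c
  linarith [hμ N]

namespace LipschitzFree

variable {M : Type*} [MetricSpace M] {z : M}

/-- The functional on the Lipschitz-free space given by a Lipschitz function. -/
noncomputable def ofLip0 (h : Lip0 z) : StrongDual ℝ (LipschitzFree z) :=
  (ContinuousLinearMap.apply ℝ ℝ h).comp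
    (Submodule.span ℝ (range (Lip0.delta z))).topologicalClosure.subtypeL

theorem norm_ofLip0_le (h : Lip0 z) : ‖ofLip0 h‖ ≤ ‖h‖ :=
  ContinuousLinearMap.opNorm_le_bound _ (norm_nonneg h) fun μ =>
    (μ.1.le_opNorm h).trans_eq (mul_comm _ _)

theorem exists_perturbation {h : Lip0 z} (hh : ‖h‖ ≤ 1) {c : ℝ} {μ : LipschitzFree z}
    (hμ : c < μ.1 h) (E : List (LipschitzFree z)) (hE : ∀ e ∈ E, e.1 h < 0) :
    ∃ r > 0, ∀ g : Lip0 z, ‖g‖ ≤ 1 → (∀ x, |g x - h x| ≤ r) →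
      c < μ.1 g ∧ ∀ e ∈ E, e.1 g < 0 := by
  induction E with
  | nil =>
    obtain ⟨r, hr, H⟩ := exists_forall_lt_apply μ hh hμ
    exact ⟨r, hr, fun g hg hgr => ⟨H g hg hgr, by simp⟩⟩
  | cons e E ih =>
    obtain ⟨r, hr, H⟩ := ih fun e' he' => hE e' (List.mem_cons_of_mem _ he')
    have he : 0 < (-e).1 h := neg_pos.2 (hE e List.mem_cons_self)
    obtain ⟨s, hs, H'⟩ := exists_forall_lt_apply (-e) hh he
    refine ⟨min r s, lt_min hr hs, fun g hg hgr => ?_⟩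
    obtain ⟨h1, h2⟩ := H g hg fun x => (hgr x).trans (min_le_left _ _)
    have h3 : 0 < (-e).1 g := H' g hg fun x => (hgr x).trans (min_le_right _ _)
    refine ⟨h1, fun e' he' => ?_⟩
    rcases List.mem_cons.1 he' with rfl | he'
    · exact neg_pos.1 h3
    · exact h2 e' he'

/-- `A` is left general so that, besides the set of strongly exposed points, it can be `{-μ}` when
there are none. -/
theorem mem_closedConv_of_mem_scdPoints {A : Set (LipschitzFree z)} (hA : A ⊆ closedBall 0 1)
    (hAne : A.Nonempty)
    (hslice : ∀ S, IsSlice (closedBall (0 : LipschitzFree z) 1) S → (S ∩ A).Nonempty ∨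
      ∀ δ > 0, ∃ x y : M, x ≠ y ∧ dist x y < δ ∧ molecule z x y ∈ S)
    {μ : LipschitzFree z} (hμ : ‖μ‖ = 1)
    (hμs : μ ∈ scdPoints (closedBall (0 : LipschitzFree z) 1)) : μ ∈ closedConv A := by
  obtain ⟨-, V, hV, hdet⟩ := hμs
  refine Metric.mem_closure_iff.2 fun ε hε => ?_
  obtain ⟨η, hη, rfl⟩ : ∃ η > 0, ε = 5 * η := ⟨ε / 5, by positivity, by ring⟩
  -- A state of the recursion: a function almost norming `μ`, and the molecules picked so far, on
  -- which it is negative.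
  let Good : Lip0 z × List (LipschitzFree z) → Prop := fun p =>
    ‖p.1‖ ≤ 1 ∧ 1 - η < μ.1 p.1 ∧ ∀ e ∈ p.2, e.1 p.1 < 0
  have hstart : ∃ p, Good p := by
    obtain ⟨h, hh, hlt⟩ := μ.1.exists_lt_apply_of_lt_opNorm (r := 1 - η) (by
      have : ‖μ.1‖ = 1 := hμ
      linarith)
    rw [Real.norm_eq_abs] at hlt
    rcases abs_choice (μ.1 h) with h1 | h1
    · exact ⟨(h, []), hh.le, by rwa [h1] at hlt, by simp⟩
    · refine ⟨(-h, []), by simpa using hh.le, ?_, by simp⟩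
      change 1 - η < μ.1 (-h)
      rwa [map_neg, ← h1]
  have hstep : ∀ (n : ℕ) (p : {p // Good p}), ∃ q : {p // Good p} × LipschitzFree z,
      (∀ e ∈ p.1.2, e ∈ q.1.1.2) ∧ q.2 ∈ V n ∧ (q.2 ∈ A ∨ q.2 ∈ q.1.1.2) := by
    rintro n ⟨⟨h, E⟩, hh, hμh, hE⟩
    rcases hslice (V n) (hV n) with ⟨e, heV, heA⟩ | hloc
    · exact ⟨⟨⟨(h, E), hh, hμh, hE⟩, e⟩, fun _ h => h, heV, Or.inl heA⟩
    · obtain ⟨r, hr, H⟩ := exists_perturbation hh hμh E hE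
      obtain ⟨x, y, hxy, hd, hm⟩ := hloc (r / 2) (by positivity)
      -- The points are exchanged so that `g` takes the value `-1` on `molecule z x y`.
      obtain ⟨g, hg, hgr, hslope⟩ := exists_slope_eq_one hh (r := r) (u := y) (v := x)
        (by rw [dist_comm]; linarith)
      obtain ⟨h1, h2⟩ := H g hg hgr
      refine ⟨⟨⟨(g, molecule z x y :: E), hg, h1, fun e he => ?_⟩, molecule z x y⟩,
        fun e he => List.mem_cons_of_mem _ he, hm, Or.inr List.mem_cons_self⟩
      rcases List.mem_cons.1 he with rfl | he
      · change (dist x y)⁻¹ * (g x - g y) < 0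
        have hpos : 0 < dist x y := dist_pos.2 hxy
        rw [dist_comm] at hslope
        exact mul_neg_of_pos_of_neg (inv_pos.2 hpos) (by linarith)
      · exact h2 e he
  choose next hnext using hstep
  obtain ⟨p₀, hp₀⟩ := hstart
  let p : ℕ → {p // Good p} := fun n => Nat.rec ⟨p₀, hp₀⟩ (fun n q => (next n q).1) n
  let e : ℕ → LipschitzFree z := fun n => (next n (p n)).2
  have heV : ∀ n, e n ∈ V n := fun n => (hnext n (p n)).2.1
  have hmono : ∀ n k, ∀ ν ∈ (p n).1.2, ν ∈ (p (n + k)).1.2 := by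
    intro n k
    induction k with
    | zero => exact fun ν hν => hν
    | succ k ih => exact fun ν hν => (hnext (n + k) (p (n + k))).1 ν (ih ν hν)
  have heball : ∀ n, e n ∈ closedBall (0 : LipschitzFree z) 1 := fun n => by
    obtain ⟨-, f, α, -, hS⟩ := hV n
    have h1 := heV n
    rw [hS] at h1
    exact h1.1
  have hμe : μ ∈ closedConv (range e) := hdet (range e)
    (by rintro _ ⟨n, rfl⟩; exact heball n) fun n => ⟨e n, mem_range_self n, heV n⟩
  obtain ⟨c, hc, hμc⟩ := mem_closedConv_of_approx hA hAne heball
    -- The shift to `n + 1` is needed because `e n`, if not in `A`, enters the list only in state `n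
    -- + 1`.
    (h := fun n => ofLip0 (p (n + 1)).1.1)
    (fun n => (norm_ofLip0_le _).trans (p (n + 1)).2.1)
    (fun n k hkn => by
      refine (hnext k (p k)).2.2.imp id fun hk => ?_
      obtain ⟨j, rfl⟩ := Nat.exists_eq_add_of_le hkn
      refine (p (k + j + 1)).2.2.2 _ ?_
      have h1 := hmono (k + 1) j _ hk
      rwa [Nat.add_right_comm] at h1)
    hη (fun n => (p (n + 1)).2.2.1) hμe
  exact ⟨c, hc, by rwa [dist_eq_norm]⟩

theorem mem_closedConv_stronglyExposedPoints [CompactSpace M] {μ : LipschitzFree z}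
    (hμ : ‖μ‖ = 1) (hμs : μ ∈ scdPoints (closedBall (0 : LipschitzFree z) 1)) :
    μ ∈ closedConv (stronglyExposedPoints (closedBall (0 : LipschitzFree z) 1)) := by
  have hM : Nontrivial M := by
    by_contra h
    rw [not_nontrivial_iff_subsingleton] at h
    have h0 : ∀ ν : LipschitzFree z, ν = 0 := fun ν => by
      refine Subtype.ext (ContinuousLinearMap.ext fun f => ?_)
      have hf : f = 0 := Lip0.ext fun x => by rw [Subsingleton.elim x z]; simp
      rw [hf, map_zero, map_zero]
    rw [h0 μ, norm_zero] at hμ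
    exact zero_ne_one hμ
  have hslice : ∀ S, IsSlice (closedBall (0 : LipschitzFree z) 1) S →
      (S ∩ stronglyExposedPoints (closedBall (0 : LipschitzFree z) 1)).Nonempty ∨
      ∀ δ > 0, ∃ x y : M, x ≠ y ∧ dist x y < δ ∧ molecule z x y ∈ S := by
    rintro _ ⟨-, f, α, hα, rfl⟩
    refine or_iff_not_imp_left.2 fun hne δ hδ => exists_molecule_mem_slice hα ?_ hδ
    exact fun ν hν hνs => hne ⟨ν, hν, hνs⟩
  rcases (stronglyExposedPoints (closedBall (0 : LipschitzFree z) 1)).eq_empty_or_nonempty with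
    he | hne
  · -- All slices contain molecules of close points, so `μ = -μ`.
    have h1 : μ ∈ closedConv {-μ} := by
      refine mem_closedConv_of_mem_scdPoints (by simp [hμ]) (singleton_nonempty _)
        (fun S hS => (hslice S hS).imp_left fun h => ?_) hμ hμs
      rw [he, inter_empty] at h
      exact absurd h not_nonempty_empty
    rw [closedConv, convexHull_singleton, closure_singleton, mem_singleton_iff] at h1
    have h2 : (2 : ℝ) • μ = 0 := (two_smul ℝ μ).trans (eq_neg_iff_add_eq_zero.1 h1)
    rw [(smul_eq_zero.1 h2).resolve_left two_ne_zero, norm_zero] at hμ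
    exact absurd hμ zero_ne_one
  · exact mem_closedConv_of_mem_scdPoints (fun ν hν => hν.1) hne hslice hμ hμs

variable (z) in
theorem scdPoints_iff_and_isSCDSet_iff [CompactSpace M] :
    (∀ μ ∈ sphere (0 : LipschitzFree z) 1,
      (μ ∈ scdPoints (closedBall (0 : LipschitzFree z) 1) ↔
        μ ∈ closedConv (stronglyExposedPoints (closedBall (0 : LipschitzFree z) 1)))) ∧
    (IsSCDSet (closedBall (0 : LipschitzFree z) 1) ↔
      closedBall (0 : LipschitzFree z) 1 =
        closedConv (stronglyExposedPoints (closedBall (0 : LipschitzFree z) 1))) := by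
  have hne : (closedConv (stronglyExposedPoints (closedBall (0 : LipschitzFree z) 1))).Nonempty →
      (stronglyExposedPoints (closedBall (0 : LipschitzFree z) 1)).Nonempty := fun h => by
    rwa [closedConv, closure_nonempty_iff, convexHull_nonempty_iff] at h
  refine ⟨fun μ hμ => ⟨fun h => ?_, fun h => ?_⟩, fun h => ?_, fun h => ?_⟩
  · exact LipschitzFree.mem_closedConv_stronglyExposedPoints (by simpa using hμ) h
  · obtain ⟨V, hV, hdet⟩ :=
      exists_slices_closedConv_stronglyExposedPoints_subset (hne ⟨μ, h⟩)
    exact ⟨sphere_subset_closedBall hμ, V, hV, fun B hB hBV => hdet B hB hBV h⟩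
  · refine Subset.antisymm ?_ (closedConv_subset (convex_closedBall _ _) isClosed_closedBall
      fun μ hμ => hμ.1)
    -- In the zero space the sphere is empty, but the zero functional strongly exposes the only
    -- point. Otherwise the ball is the convex hull of the sphere, where the pointwise result
    -- applies.
    rcases subsingleton_or_nontrivial (LipschitzFree z) with hs | hn
    · intro μ hμ
      exact subset_closedConv _ ⟨hμ, 0, fun y _ => le_rfl, fun u _ _ => by
        rw [show u = fun _ => μ from funext fun n => Subsingleton.elim _ _]
        exact tendsto_const_nhds⟩
    · obtain ⟨V, hV, hdet⟩ := h
      refine (convexHull_sphere_eq_closedBall (0 : LipschitzFree z) zero_le_one).ge.trans ?_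
      refine convexHull_min (fun μ hμ => ?_) (convex_closedConv _)
      exact LipschitzFree.mem_closedConv_stronglyExposedPoints (by simpa using hμ)
        ⟨sphere_subset_closedBall hμ, V, hV,
          fun B hB hBV => hdet B hB hBV (sphere_subset_closedBall hμ)⟩
  · obtain ⟨V, hV, hdet⟩ := exists_slices_closedConv_stronglyExposedPoints_subset
      (hne (h ▸ ⟨0, by simp⟩))
    exact ⟨V, hV, fun B hB hBV => h.subset.trans (hdet B hB hBV)⟩

end LipschitzFree

end

theorem theorem5p3 {M : Type*} [MetricSpace M] [CompactSpace M] (z : M) :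
    (∀ μ ∈ sphere (0 : LipschitzFree z) 1,
      (μ ∈ scdPoints (closedBall (0 : LipschitzFree z) 1) ↔
        μ ∈ closedConv (stronglyExposedPoints (closedBall (0 : LipschitzFree z) 1)))) ∧
    (IsSCDSet (closedBall (0 : LipschitzFree z) 1) ↔
      closedBall (0 : LipschitzFree z) 1 =
        closedConv (stronglyExposedPoints (closedBall (0 : LipschitzFree z) 1))) :=
  LipschitzFree.scdPoints_iff_and_isSCDSet_iff z
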